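/- Let $M_d$ denote the space of $d\times d$ complex matrices and $\|\cdot\|_\infty$ the operator norm on it. Let $k,d$ be integers with $1<k\le d$, and let $\Gamma:M_d\to M_d$ be a positive linear map (i.e. $\Gamma$ maps positive semidefinite matrices to positive semidefinite matrices) such that $$\|\operatorname{tr}(X)\,I_d-\Gamma(X)\|_\infty\le\frac1k\,\|X\|_\infty\qquad\text{for all }X\in M_d .$$ Then $\Gamma$ is $k$-entanglement breaking. That is, $\Gamma$ is $k$-positive (the map $\mathrm{id}_k\otimes\Gamma$ on $M_k\otimes M_d$ is positive), and for every positive semidefinite $X\in M_k\otimes M_d$ the matrix $(\mathrm{id}_k\otimes\Gamma)(X)$ is separable, i.e. it can be written as a finite sum $\sum_i A_i\otimes B_i$ with $A_i\in M_k$ and $B_i\in M_d$ positive semidefinite. -/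

import Mathlib

open scoped Matrix Kronecker ComplexOrder Matrix.Norms.L2Operator

/-- The ampliation `id_k ⊗ Φ : M_k ⊗ M_{d₁} → M_k ⊗ M_{d₂}`. Here `M_k ⊗ M_d` is the space of
matrices indexed by `Fin k × Fin d`, i.e. of `k × k` block matrices with blocks in `M_d`, and
`id_k ⊗ Φ` applies `Φ` to every block. -/
def ampliation (k : ℕ) {d₁ d₂ : ℕ}
    (Φ : Matrix (Fin d₁) (Fin d₁) ℂ →ₗ[ℂ] Matrix (Fin d₂) (Fin d₂) ℂ) :
    Matrix (Fin k × Fin d₁) (Fin k × Fin d₁) ℂ →ₗ[ℂ]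
      Matrix (Fin k × Fin d₂) (Fin k × Fin d₂) ℂ where
  toFun X := Matrix.of fun p q =>
    Φ (Matrix.of fun a b => X (p.1, a) (q.1, b)) p.2 q.2
  map_add' X Y := by
    ext p q
    simp only [Matrix.of_apply, Matrix.add_apply]
    rw [← Matrix.add_apply, ← map_add]
    rfl
  map_smul' c X := by
    ext p q
    simp only [Matrix.of_apply, Matrix.smul_apply, RingHom.id_apply]
    rw [← Matrix.smul_apply, ← map_smul]
    rfl

/-- On elementary tensors `id_k ⊗ Φ` is `A ⊗ B ↦ A ⊗ Φ B`. -/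
theorem ampliation_kronecker (k : ℕ) {d₁ d₂ : ℕ}
    (Φ : Matrix (Fin d₁) (Fin d₁) ℂ →ₗ[ℂ] Matrix (Fin d₂) (Fin d₂) ℂ)
    (A : Matrix (Fin k) (Fin k) ℂ) (B : Matrix (Fin d₁) (Fin d₁) ℂ) :
    ampliation k Φ (A ⊗ₖ B) = A ⊗ₖ Φ B := by
  ext p q
  have h : (Matrix.of fun a b => (A ⊗ₖ B) (p.1, a) (q.1, b)) = A p.1 q.1 • B := by
    ext a b; simp [Matrix.kroneckerMap_apply]
  change Φ (Matrix.of fun a b => (A ⊗ₖ B) (p.1, a) (q.1, b)) p.2 q.2 = _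
  rw [h, map_smul]
  simp [Matrix.kroneckerMap_apply]

/-- A matrix in `M_{d₁} ⊗ M_{d₂}` is separable if it is a finite sum of Kronecker products of
positive semidefinite matrices. -/
def IsSeparableMatrix {d₁ d₂ : ℕ} (X : Matrix (Fin d₁ × Fin d₂) (Fin d₁ × Fin d₂) ℂ) : Prop :=
  ∃ (n : ℕ) (A : Fin n → Matrix (Fin d₁) (Fin d₁) ℂ) (B : Fin n → Matrix (Fin d₂) (Fin d₂) ℂ),
    (∀ i, (A i).PosSemidef) ∧ (∀ i, (B i).PosSemidef) ∧ X = ∑ i, A i ⊗ₖ B i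

/-- A linear map between matrix spaces is positive if it maps positive semidefinite matrices to
positive semidefinite matrices. -/
def IsPositiveMap {m n : Type*} [Fintype m] [Fintype n]
    (Φ : Matrix m m ℂ →ₗ[ℂ] Matrix n n ℂ) : Prop :=
  ∀ X : Matrix m m ℂ, X.PosSemidef → (Φ X).PosSemidef

/-- `Φ` is `k`-positive if `id_k ⊗ Φ` is positive. -/
def IsKPositiveMap (k : ℕ) {d₁ d₂ : ℕ}
    (Φ : Matrix (Fin d₁) (Fin d₁) ℂ →ₗ[ℂ] Matrix (Fin d₂) (Fin d₂) ℂ) : Prop :=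
  IsPositiveMap (ampliation k Φ)

/-- `Φ` is `k`-entanglement breaking if it is `k`-positive and `(id_k ⊗ Φ)(X)` is separable for
every positive semidefinite `X ∈ M_k ⊗ M_{d₁}`. -/
def IsKEntanglementBreaking (k : ℕ) {d₁ d₂ : ℕ}
    (Φ : Matrix (Fin d₁) (Fin d₁) ℂ →ₗ[ℂ] Matrix (Fin d₂) (Fin d₂) ℂ) : Prop :=
  IsKPositiveMap k Φ ∧
    ∀ X : Matrix (Fin k × Fin d₁) (Fin k × Fin d₁) ℂ, X.PosSemidef →
      IsSeparableMatrix (ampliation k Φ X)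

/-! By linearity it suffices to treat `X = ψψ*`. Write `ψ = ∑ c_i ⊗ f_i` with `f` orthonormal and `m
≤ k` terms. With `L_ij = tr(f_i f_j*)1 - Γ(f_i f_j*)`, of norm at most `1/k`, the image is `∑_i c_i
c_i* ⊗ 1 - ∑_ij c_i c_j* ⊗ L_ij`. Each pair of terms `(i,j)`, `(j,i)` becomes separable once
`(1/k)(c_i c_i* + c_j c_j*) ⊗ 1` is added; this costs `m/k ≤ 1` times the first sum in total.

The separability of a pair rests on writing a contraction as `∑ z_i P_i` with `|z_i| = 1`, `P_i ≥ 0`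
and `∑ P_i = 1`. Finally, separable matrices are positive semidefinite, which gives `k`-positivity.
-/

/-! ### Contractions as circle averages -/

open scoped MatrixOrder in
theorem Matrix.norm_fromBlocks_antidiagonal_le_one {n : Type*} [Fintype n] [DecidableEq n]
    (A : Matrix n n ℂ) (hA : ‖A‖ ≤ 1) :
    ‖Matrix.fromBlocks 0 Aᴴ A 0‖ ≤ 1 := by
  have key : ∀ B : Matrix n n ℂ, ‖B‖ ≤ 1 → ∃ C : Matrix n n ℂ, 1 - Bᴴ * B = Cᴴ * C := by
    intro B hB
    have h : (Bᴴ * B) ≤ 1 := by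
      rw [← CStarAlgebra.norm_le_one_iff_of_nonneg _
        (Matrix.nonneg_iff_posSemidef.2 (Matrix.posSemidef_conjTranspose_mul_self B)),
        Matrix.l2_opNorm_conjTranspose_mul_self]
      nlinarith [norm_nonneg B]
    obtain ⟨C, hC⟩ := CStarAlgebra.nonneg_iff_eq_star_mul_self.1 (sub_nonneg.2 h)
    exact ⟨C, hC⟩
  obtain ⟨B, hB⟩ := key A hA
  obtain ⟨C, hC⟩ := key Aᴴ (by rwa [Matrix.l2_opNorm_conjTranspose])
  set M := Matrix.fromBlocks 0 Aᴴ A 0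
  have hM : Mᴴ * M ≤ 1 := by
    rw [Matrix.le_iff]
    have : 1 - Mᴴ * M = (Matrix.fromBlocks B 0 0 C)ᴴ * Matrix.fromBlocks B 0 0 C := by
      simp only [M, Matrix.fromBlocks_conjTranspose, Matrix.fromBlocks_multiply,
        ← Matrix.fromBlocks_one, sub_eq_add_neg, Matrix.fromBlocks_neg, Matrix.fromBlocks_add]
      simp [← hB, ← hC, sub_eq_add_neg]
    rw [this]
    exact Matrix.posSemidef_conjTranspose_mul_self _
  rw [← CStarAlgebra.norm_le_one_iff_of_nonneg _
    (Matrix.nonneg_iff_posSemidef.2 (Matrix.posSemidef_conjTranspose_mul_self M)),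
    Matrix.l2_opNorm_conjTranspose_mul_self] at hM
  nlinarith [norm_nonneg M]

/-- `A` is the integral of the identity function of the unit circle against a finitely supported
positive-operator-valued measure of total mass `1`. -/
def IsCircleAverage {n : Type*} [Fintype n] [DecidableEq n] (A : Matrix n n ℂ) : Prop :=
  ∃ (ι : Type) (_ : Fintype ι) (z : ι → ℂ) (P : ι → Matrix n n ℂ),
    (∀ i, z i * star (z i) = 1) ∧ (∀ i, (P i).PosSemidef) ∧ ∑ i, P i = 1 ∧ ∑ i, z i • P i = A

theorem isCircleAverage_of_mem_unitary {n : Type*} [Fintype n] [DecidableEq n]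
    (U : Matrix n n ℂ) (hU : U ∈ unitary (Matrix n n ℂ)) : IsCircleAverage U := by
  have hfin : (spectrum ℂ U).Finite := U.finite_spectrum
  let _ : Fintype (spectrum ℂ U) := hfin.fintype
  have hn : IsStarNormal U := ⟨hU.1.trans hU.2.symm⟩
  have hc : ∀ f : ℂ → ℂ, ContinuousOn f (spectrum ℂ U) := fun f => hfin.continuousOn f
  let χ : spectrum ℂ U → ℂ → ℂ := fun z w => if w = z then 1 else 0
  refine ⟨spectrum ℂ U, inferInstance, fun z => z, fun z => cfc (χ z) U, ?_, ?_, ?_, ?_⟩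
  · intro z
    have h := spectrum.subset_circle_of_unitary hU z.2
    rw [mem_sphere_zero_iff_norm] at h
    change (z : ℂ) * (starRingEnd ℂ) z = 1
    rw [Complex.mul_conj, Complex.normSq_eq_norm_sq, h]
    simp
  -- The weights are the spectral projections of `U`, so each equals `P* P`.
  · intro z
    have : cfc (χ z) U = (cfc (χ z) U)ᴴ * cfc (χ z) U := by
      rw [← Matrix.star_eq_conjTranspose, ← cfc_star, ← cfc_mul _ _ U (hc _) (hc _)]
      congr 1
      ext w
      by_cases h : w = z <;> simp [χ, h]
    change (cfc (χ z) U).PosSemidef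
    rw [this]
    exact Matrix.posSemidef_conjTranspose_mul_self _
  · rw [← cfc_sum_univ _ U (fun _ => hc _), ← cfc_one ℂ U]
    refine cfc_congr fun w hw => ?_
    rw [Finset.sum_apply, Finset.sum_eq_single ⟨w, hw⟩]
    · simp [χ]
    · intro z _ hz
      have : w ≠ z := fun h => hz (Subtype.ext h.symm)
      simp [χ, this]
    · simp
  · simp_rw [← fun z : spectrum ℂ U => cfc_const_mul (z : ℂ) (χ z) U (hc _)]
    rw [← cfc_sum_univ _ U (fun _ => hc _)]
    conv_rhs => rw [← cfc_id ℂ U]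
    refine cfc_congr fun w hw => ?_
    rw [Finset.sum_apply, Finset.sum_eq_single ⟨w, hw⟩]
    · simp [χ]
    · intro z _ hz
      have : w ≠ z := fun h => hz (Subtype.ext h.symm)
      simp [χ, this]
    · simp

theorem IsCircleAverage.midpoint {n : Type*} [Fintype n] [DecidableEq n] {A B : Matrix n n ℂ}
    (hA : IsCircleAverage A) (hB : IsCircleAverage B) :
    IsCircleAverage ((1 / 2 : ℂ) • (A + B)) := by
  obtain ⟨ι, _, z, P, hz, hP, hP1, hzP⟩ := hA
  obtain ⟨κ, _, w, Q, hw, hQ, hQ1, hwQ⟩ := hB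
  have h2 : (0 : ℂ) ≤ 1 / 2 := by norm_num [Complex.le_def]
  refine ⟨ι ⊕ κ, inferInstance, Sum.elim z w, fun i => (1 / 2 : ℂ) • Sum.elim P Q i, ?_, ?_, ?_, ?_⟩
  · rintro (i | i)
    exacts [hz i, hw i]
  · rintro (i | i)
    exacts [(hP i).smul h2, (hQ i).smul h2]
  · rw [← Finset.smul_sum, Fintype.sum_sum_type]
    simp only [Sum.elim_inl, Sum.elim_inr, hP1, hQ1]
    module
  · simp_rw [smul_comm _ (1 / 2 : ℂ)]
    rw [← Finset.smul_sum, Fintype.sum_sum_type]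
    simp only [Sum.elim_inl, Sum.elim_inr, hzP, hwQ]

theorem IsCircleAverage.toBlocks₁₁ {n m : Type*} [Fintype n] [DecidableEq n] [Fintype m]
    [DecidableEq m] {A : Matrix (n ⊕ m) (n ⊕ m) ℂ} (hA : IsCircleAverage A) :
    IsCircleAverage A.toBlocks₁₁ := by
  obtain ⟨ι, _, z, P, hz, hP, hP1, hzP⟩ := hA
  refine ⟨ι, inferInstance, z, fun i => (P i).toBlocks₁₁, hz,
    fun i => (hP i).submatrix Sum.inl, ?_, ?_⟩
  · ext a b
    have := congr_fun (congr_fun hP1 (Sum.inl a)) (Sum.inl b)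
    simpa [Matrix.sum_apply, Matrix.one_apply, Matrix.toBlocks₁₁] using this
  · ext a b
    have := congr_fun (congr_fun hzP (Sum.inl a)) (Sum.inl b)
    simpa [Matrix.sum_apply, Matrix.toBlocks₁₁] using this

-- The self-adjoint contraction `M` is the mean of the unitaries `M ± i√(1 - M²)`. Multiplying by
-- the flip `J` moves `A` to the upper left corner, and compression to a corner preserves circle
-- averages.
open scoped MatrixOrder in
theorem isCircleAverage_of_norm_le_one {n : Type*} [Fintype n] [DecidableEq n]
    (A : Matrix n n ℂ) (hA : ‖A‖ ≤ 1) : IsCircleAverage A := by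
  set M := Matrix.fromBlocks 0 Aᴴ A 0
  have hM : IsSelfAdjoint M := by
    change Mᴴ = M
    simp [M, Matrix.fromBlocks_conjTranspose]
  have hM1 : ‖M‖ ≤ 1 := Matrix.norm_fromBlocks_antidiagonal_le_one A hA
  set J : Matrix (n ⊕ n) (n ⊕ n) ℂ := Matrix.fromBlocks 0 1 1 0
  have hJJ : J * J = 1 := by simp [J, Matrix.fromBlocks_multiply, Matrix.fromBlocks_one]
  have hJs : star J = J := by
    change Jᴴ = J
    simp [J, Matrix.fromBlocks_conjTranspose]
  have hJ : J ∈ unitary (Matrix (n ⊕ n) (n ⊕ n) ℂ) := by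
    rw [Unitary.mem_iff, hJs]
    exact ⟨hJJ, hJJ⟩
  let u := selfAdjoint.unitarySelfAddISMul ⟨M, hM⟩ hM1
  have hu : (u : Matrix (n ⊕ n) (n ⊕ n) ℂ) + star (u : Matrix (n ⊕ n) (n ⊕ n) ℂ) = (2 : ℂ) • M := by
    have h : star (u : Matrix (n ⊕ n) (n ⊕ n) ℂ) = M - Complex.I • CFC.sqrt (1 - M ^ 2) :=
      selfAdjoint.star_coe_unitarySelfAddISMul ⟨M, hM⟩ hM1
    rw [h]
    change M + Complex.I • CFC.sqrt (1 - M ^ 2) + _ = _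
    module
  have h := ((isCircleAverage_of_mem_unitary _ (mul_mem hJ u.2)).midpoint
    (isCircleAverage_of_mem_unitary _ (mul_mem hJ (star u).2))).toBlocks₁₁
  rw [Unitary.coe_star, ← mul_add, hu] at h
  convert h using 1
  rw [mul_smul_comm, smul_smul]
  norm_num [J, M, Matrix.fromBlocks_multiply]

/-! ### The cone of separable matrices -/

theorem isSeparableMatrix_sum_kronecker {k d : ℕ} {ι : Type*} [Fintype ι]
    (A : ι → Matrix (Fin k) (Fin k) ℂ) (B : ι → Matrix (Fin d) (Fin d) ℂ)
    (hA : ∀ i, (A i).PosSemidef) (hB : ∀ i, (B i).PosSemidef) :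
    IsSeparableMatrix (∑ i, A i ⊗ₖ B i) := by
  let e := Fintype.equivFin ι
  exact ⟨Fintype.card ι, A ∘ e.symm, B ∘ e.symm, fun i => hA _, fun i => hB _,
    (e.symm.sum_comp fun i => A i ⊗ₖ B i).symm⟩

theorem isSeparableMatrix_kronecker {k d : ℕ} {A : Matrix (Fin k) (Fin k) ℂ}
    {B : Matrix (Fin d) (Fin d) ℂ} (hA : A.PosSemidef) (hB : B.PosSemidef) :
    IsSeparableMatrix (A ⊗ₖ B) := by
  simpa using isSeparableMatrix_sum_kronecker (fun _ : Unit => A) (fun _ => B)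
    (fun _ => hA) (fun _ => hB)

theorem IsSeparableMatrix.add {k d : ℕ} {X Y : Matrix (Fin k × Fin d) (Fin k × Fin d) ℂ}
    (hX : IsSeparableMatrix X) (hY : IsSeparableMatrix Y) : IsSeparableMatrix (X + Y) := by
  obtain ⟨m, A, B, hA, hB, rfl⟩ := hX
  obtain ⟨n, A', B', hA', hB', rfl⟩ := hY
  have h := isSeparableMatrix_sum_kronecker (Sum.elim A A') (Sum.elim B B')
    (Sum.forall.2 ⟨hA, hA'⟩) (Sum.forall.2 ⟨hB, hB'⟩)
  rwa [Fintype.sum_sum_type] at h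

theorem IsSeparableMatrix.sum {k d : ℕ} {ι : Type*} (s : Finset ι)
    (X : ι → Matrix (Fin k × Fin d) (Fin k × Fin d) ℂ) (hX : ∀ i, IsSeparableMatrix (X i)) :
    IsSeparableMatrix (∑ i ∈ s, X i) := by
  classical
  induction s using Finset.induction_on with
  | empty => exact ⟨0, 0, 0, fun i => i.elim0, fun i => i.elim0, by simp⟩
  | insert i s hi ih => rw [Finset.sum_insert hi]; exact (hX i).add ih

theorem IsSeparableMatrix.smul {k d : ℕ} {X : Matrix (Fin k × Fin d) (Fin k × Fin d) ℂ}
    (hX : IsSeparableMatrix X) {c : ℂ} (hc : 0 ≤ c) : IsSeparableMatrix (c • X) := by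
  obtain ⟨n, A, B, hA, hB, rfl⟩ := hX
  refine ⟨n, fun i => c • A i, B, fun i => (hA i).smul hc, hB, ?_⟩
  simp [Finset.smul_sum, Matrix.smul_kronecker]

theorem IsSeparableMatrix.posSemidef {k d : ℕ}
    {X : Matrix (Fin k × Fin d) (Fin k × Fin d) ℂ} (hX : IsSeparableMatrix X) :
    X.PosSemidef := by
  obtain ⟨n, A, B, hA, hB, rfl⟩ := hX
  exact Matrix.posSemidef_sum _ fun i _ => (hA i).kronecker (hB i)

-- If `A = ∑ z_i P_i` is a circle average, the matrix equals `∑ w_i w_i* ⊗ P_i` with `w_i = u - z̄_i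
-- v`.
open Matrix in
theorem isSeparableMatrix_of_norm_le_one {k d : ℕ} (u v : Fin k → ℂ)
    (A : Matrix (Fin d) (Fin d) ℂ) (hA : ‖A‖ ≤ 1) :
    IsSeparableMatrix ((vecMulVec u (star u) + vecMulVec v (star v)) ⊗ₖ 1
      - vecMulVec u (star v) ⊗ₖ A - vecMulVec v (star u) ⊗ₖ Aᴴ) := by
  obtain ⟨ι, _, z, P, hz, hP, hP1, hzP⟩ := isCircleAverage_of_norm_le_one A hA
  have hA' : Aᴴ = ∑ i, star (z i) • P i := by
    rw [← hzP, conjTranspose_sum]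
    refine Finset.sum_congr rfl fun i _ => ?_
    rw [conjTranspose_smul, (hP i).isHermitian.eq]
  convert isSeparableMatrix_sum_kronecker
    (fun i => vecMulVec (u - star (z i) • v) (star (u - star (z i) • v))) P
    (fun i => posSemidef_vecMulVec_self_star _) hP using 1
  rw [hA', ← hP1, ← hzP]
  ext ⟨a, x⟩ ⟨b, y⟩
  simp only [Matrix.sub_apply, Matrix.add_apply, Matrix.sum_apply, Matrix.smul_apply, kroneckerMap_apply, vecMulVec_apply,
    Finset.mul_sum, ← Finset.sum_sub_distrib, Pi.sub_apply, Pi.star_apply, Pi.smul_apply,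
    smul_eq_mul, star_sub, star_mul', star_star]
  refine Finset.sum_congr rfl fun i _ => ?_
  linear_combination (-(v a * star (v b) * P i x y)) * hz i

open Matrix in
theorem isSeparableMatrix_of_norm_le {k d : ℕ} (u v : Fin k → ℂ)
    (A : Matrix (Fin d) (Fin d) ℂ) {r : ℝ} (hr : 0 < r) (hA : ‖A‖ ≤ r) :
    IsSeparableMatrix ((r : ℂ) • (vecMulVec u (star u) + vecMulVec v (star v)) ⊗ₖ 1
      - vecMulVec u (star v) ⊗ₖ A - vecMulVec v (star u) ⊗ₖ Aᴴ) := by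
  have hr' : (r : ℂ) ≠ 0 := by exact_mod_cast hr.ne'
  have h := (isSeparableMatrix_of_norm_le_one u v (((r : ℂ)⁻¹) • A) (by
    rw [norm_smul, norm_inv, Complex.norm_real, Real.norm_of_nonneg hr.le]
    rw [inv_mul_le_iff₀ hr]
    simpa using hA)).smul (c := (r : ℂ)) (by exact_mod_cast hr.le)
  convert h using 1
  simp [smul_sub, Matrix.kronecker_smul, conjTranspose_smul, smul_smul, hr']

/-! ### Rank-one inputs -/

-- Polarization: compare the Hermitian images of `ww*` for `w = u + v` and `w = u + iv`.
open Matrix in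
theorem IsPositiveMap.map_vecMulVec_conjTranspose {m n : Type*} [Fintype m] [Fintype n]
    {Φ : Matrix m m ℂ →ₗ[ℂ] Matrix n n ℂ} (hΦ : IsPositiveMap Φ) (u v : m → ℂ) :
    (Φ (vecMulVec u (star v)))ᴴ = Φ (vecMulVec v (star u)) := by
  have key : ∀ w : m → ℂ, (Φ (vecMulVec w (star w)))ᴴ = Φ (vecMulVec w (star w)) := fun w =>
    (hΦ _ (posSemidef_vecMulVec_self_star w)).isHermitian
  have h1 := key (u + v)
  have h2 := key (u + Complex.I • v)
  simp only [star_add, star_smul, add_vecMulVec, vecMulVec_add, smul_vecMulVec, vecMulVec_smul,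
    map_add, map_smul, conjTranspose_add, conjTranspose_smul, key] at h1 h2
  ext a b
  have h1' := congr_fun (congr_fun h1 a) b
  have h2' := congr_fun (congr_fun h2 a) b
  simp only [Matrix.add_apply, Matrix.smul_apply, smul_eq_mul, Complex.star_def, Complex.conj_I, map_neg,
    neg_neg] at h1' h2'
  linear_combination (1 / 2) * h1' + (-1 / 2) * Complex.I * h2'
    + (1 / 2) * ((Φ (vecMulVec u (star v)))ᴴ a b - Φ (vecMulVec v (star u)) a b
      - (Φ (vecMulVec v (star u)))ᴴ a b + Φ (vecMulVec u (star v)) a b) * Complex.I_sq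

open Matrix in
theorem norm_vecMulVec_star_le_one {n : Type*} [Fintype n] [DecidableEq n] (u v : n → ℂ)
    (hu : star u ⬝ᵥ u = 1) (hv : star v ⬝ᵥ v = 1) :
    ‖vecMulVec u (star v)‖ ≤ 1 := by
  have h1 : ∀ w x : n → ℂ, star w ⬝ᵥ w = 1 →
      (vecMulVec w (star x))ᴴ * vecMulVec w (star x) = vecMulVec x (star x) := by
    intro w x hw
    rw [conjTranspose_vecMulVec, star_star, vecMulVec_mul_vecMulVec, hw, one_smul]
  -- The C*-identity gives `‖vv*‖² = ‖vv*‖` and `‖uv*‖² = ‖vv*‖`.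
  have h2 := congr_arg norm (h1 v v hv)
  have h3 := congr_arg norm (h1 u v hu)
  rw [l2_opNorm_conjTranspose_mul_self] at h2 h3
  have h4 : ‖vecMulVec v (star v)‖ ≤ 1 := by
    by_contra! h
    nlinarith
  nlinarith [norm_nonneg (vecMulVec u (star v))]

open Matrix in
theorem exists_orthonormal_expansion {k d : ℕ} (ψ : Fin k × Fin d → ℂ) :
    ∃ (m : ℕ) (c : Fin m → Fin k → ℂ) (f : Fin m → Fin d → ℂ), m ≤ k ∧
      (∀ i j, star (f i) ⬝ᵥ f j = if i = j then 1 else 0) ∧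
      ∀ a x, ψ (a, x) = ∑ i, c i a * f i x := by
  let w : Fin k → EuclideanSpace ℂ (Fin d) := fun a => WithLp.toLp 2 fun x => ψ (a, x)
  let S := Submodule.span ℂ (Set.range w)
  let b := stdOrthonormalBasis ℂ S
  let g : Fin k → S := fun a => ⟨w a, Submodule.subset_span ⟨a, rfl⟩⟩
  -- The `k` rows of `ψ` span a space of dimension at most `k`; `f` is an orthonormal basis of it.
  refine ⟨Module.finrank ℂ S, fun i a => b.repr (g a) i, fun i x => (b i : EuclideanSpace ℂ (Fin d)) x,
    by simpa [Set.finrank] using! finrank_range_le_card (R := ℂ) w, ?_, ?_⟩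
  · intro i j
    have h := orthonormal_iff_ite.1 b.orthonormal i j
    rw [← h, Submodule.coe_inner, EuclideanSpace.inner_eq_star_dotProduct, dotProduct_comm]
  · intro a x
    have h := congr_arg (fun s : S => (s : EuclideanSpace ℂ (Fin d)) x) (b.sum_repr (g a))
    simpa [g, w] using h.symm

open Matrix in
theorem isSeparableMatrix_ampliation_vecMulVec {k d : ℕ} (hk : 0 < k)
    {Γ : Matrix (Fin d) (Fin d) ℂ →ₗ[ℂ] Matrix (Fin d) (Fin d) ℂ} (hpos : IsPositiveMap Γ)
    (hnorm : ∀ X : Matrix (Fin d) (Fin d) ℂ,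
      ‖Matrix.trace X • (1 : Matrix (Fin d) (Fin d) ℂ) - Γ X‖ ≤ (1 / (k : ℝ)) * ‖X‖)
    (ψ : Fin k × Fin d → ℂ) :
    IsSeparableMatrix (ampliation k Γ (vecMulVec ψ (star ψ))) := by
  obtain ⟨m, c, f, hm, hf, hψ⟩ := exists_orthonormal_expansion ψ
  have hkR : (0 : ℝ) < k := by exact_mod_cast hk
  let C : Fin m → Fin m → Matrix (Fin k) (Fin k) ℂ := fun i j => vecMulVec (c i) (star (c j))
  let F : Fin m → Fin m → Matrix (Fin d) (Fin d) ℂ := fun i j => vecMulVec (f i) (star (f j))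
  let L : Fin m → Fin m → Matrix (Fin d) (Fin d) ℂ := fun i j => trace (F i j) • 1 - Γ (F i j)
  have htr : ∀ i j, trace (F i j) = if i = j then 1 else 0 := fun i j => by
    simp only [F, trace_vecMulVec, dotProduct_comm (f i), hf, eq_comm]
  have hL : ∀ i j, ‖L i j‖ ≤ 1 / (k : ℝ) := fun i j => by
    refine (hnorm _).trans (mul_le_of_le_one_right (by positivity) ?_)
    exact norm_vecMulVec_star_le_one _ _ (by simp [hf]) (by simp [hf])
  have hLs : ∀ i j, (L i j)ᴴ = L j i := fun i j => by
    simp only [L, F, conjTranspose_sub, hpos.map_vecMulVec_conjTranspose, conjTranspose_smul,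
      conjTranspose_one]
    rw [← trace_conjTranspose, conjTranspose_vecMulVec, star_star]
  have hψψ : vecMulVec ψ (star ψ) = ∑ i, ∑ j, C i j ⊗ₖ F i j := by
    ext ⟨a, x⟩ ⟨b, y⟩
    simp only [vecMulVec_apply, Pi.star_apply, hψ, Matrix.sum_apply, kroneckerMap_apply, C, F, star_sum,
      Finset.sum_mul_sum, star_mul']
    exact Finset.sum_congr rfl fun i _ => Finset.sum_congr rfl fun j _ => by ring
  have hamp : ampliation k Γ (vecMulVec ψ (star ψ))
      = (∑ i, C i i) ⊗ₖ 1 - ∑ i, ∑ j, C i j ⊗ₖ L i j := by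
    have hΓ : ∀ i j, Γ (F i j) = (if i = j then (1 : ℂ) else 0) • 1 - L i j := fun i j => by
      simp [L, htr]
    simp only [hψψ, map_sum, ampliation_kronecker, hΓ]
    ext p q
    simp [Matrix.sum_apply, kroneckerMap_apply, mul_sub, Finset.sum_sub_distrib, Finset.sum_mul]
    refine Finset.sum_congr rfl fun i _ => ?_
    rw [Finset.sum_eq_single i (fun j _ hj => by simp [hj.symm]) (by simp)]
    simp
  -- The sum runs over all ordered pairs, diagonal included, so each `C i j ⊗ₖ L i j` occurs twice;
  -- hence the factor `1/2`.
  have hpair : IsSeparableMatrix ((1 / 2 : ℂ) • ∑ i, ∑ j,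
      ((((1 / (k : ℝ) : ℝ)) : ℂ) • (C i i + C j j) ⊗ₖ (1 : Matrix (Fin d) (Fin d) ℂ)
        - C i j ⊗ₖ L i j - C j i ⊗ₖ L j i)) := by
    refine IsSeparableMatrix.smul (.sum _ _ fun i => .sum _ _ fun j => ?_)
      (by norm_num [Complex.le_def])
    rw [← hLs i j]
    exact isSeparableMatrix_of_norm_le _ _ _ (by positivity) (hL i j)
  -- What the pairs leave of `∑ C i i ⊗ₖ 1`; here `m ≤ k` enters.
  have hdiag : IsSeparableMatrix ((((1 - m / k : ℝ)) : ℂ) •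
      ((∑ i, C i i) ⊗ₖ (1 : Matrix (Fin d) (Fin d) ℂ))) := by
    refine IsSeparableMatrix.smul (isSeparableMatrix_kronecker
      (posSemidef_sum _ fun i _ => posSemidef_vecMulVec_self_star _) .one) ?_
    have : (m : ℝ) / k ≤ 1 := (div_le_one hkR).2 (by exact_mod_cast hm)
    exact_mod_cast sub_nonneg.2 this
  convert hdiag.add hpair using 1
  have hsum : ∑ i, ∑ j, (C i i + C j j) ⊗ₖ (1 : Matrix (Fin d) (Fin d) ℂ)
      = (2 * m : ℂ) • ((∑ i, C i i) ⊗ₖ (1 : Matrix (Fin d) (Fin d) ℂ)) := by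
    ext p q
    simp [Matrix.sum_apply, kroneckerMap_apply, add_mul, Finset.sum_add_distrib, Finset.sum_mul,
      ← Finset.mul_sum]
    ring
  have hswap : ∑ i, ∑ j, C j i ⊗ₖ L j i = ∑ i, ∑ j, C i j ⊗ₖ L i j := Finset.sum_comm
  simp only [Finset.sum_sub_distrib, ← Finset.smul_sum, hswap, hsum, hamp]
  push_cast
  module

theorem mainTheorem9 (k d : ℕ) (hk : 1 < k) (hkd : k ≤ d)
    (Γ : Matrix (Fin d) (Fin d) ℂ →ₗ[ℂ] Matrix (Fin d) (Fin d) ℂ)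
    (hpos : IsPositiveMap Γ)
    (hnorm : ∀ X : Matrix (Fin d) (Fin d) ℂ,
      ‖Matrix.trace X • (1 : Matrix (Fin d) (Fin d) ℂ) - Γ X‖ ≤ (1 / (k : ℝ)) * ‖X‖) :
    IsKEntanglementBreaking k Γ := by
  have h : ∀ X : Matrix (Fin k × Fin d) (Fin k × Fin d) ℂ, X.PosSemidef →
      IsSeparableMatrix (ampliation k Γ X) := by
    intro X hX
    obtain ⟨n, ψ, rfl⟩ := Matrix.posSemidef_iff_eq_sum_vecMulVec.1 hX
    rw [map_sum]
    exact .sum _ _ fun i =>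
      isSeparableMatrix_ampliation_vecMulVec (zero_lt_one.trans hk) hpos hnorm (ψ i)
  exact ⟨fun X hX => (h X hX).posSemidef, h⟩
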